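/- Let $X$ be a finite set and let $G$ be a $2$-transitive group of permutations of $X$, i.e. for all $a\ne b$ and $c\ne d$ in $X$ there is $g\in G$ with $g(a)=c$ and $g(b)=d$. Let $\overline G$ be the monoid, under composition, consisting of the elements of $G$ together with all constant maps $X\to X$. Let $k$ be an algebraically closed field of characteristic $0$. Then the monoid algebra $k\overline G$ is of finite representation type, i.e. up to isomorphism there are only finitely many indecomposable finitely generated (equivalently, finite-dimensional) $k\overline G$-modules. -/

import Mathlib

universe u v

/-- The monoid of self-maps of `X` consisting of the permutations in `G` together with all
constant maps; the product is composition of maps, `(f * g) x = f (g x)`. -/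
def adjoinConstants {X : Type u} (G : Subgroup (Equiv.Perm X)) : Submonoid (Function.End X) where
  carrier := {f | (∃ g ∈ G, f = (g : X → X)) ∨ ∃ x : X, f = Function.const X x}
  one_mem' := Or.inl ⟨1, G.one_mem, rfl⟩
  mul_mem' := by
    rintro _ _ (⟨g, hg, rfl⟩ | ⟨x, rfl⟩) (⟨h, hh, rfl⟩ | ⟨y, rfl⟩)
    · exact Or.inl ⟨g * h, G.mul_mem hg hh, rfl⟩
    · exact Or.inr ⟨g y, rfl⟩
    · exact Or.inr ⟨x, rfl⟩
    · exact Or.inr ⟨x, rfl⟩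

/-- A module is indecomposable if it is nonzero and is not the internal direct sum of two nonzero
submodules. -/
def IsIndecomposableModule (A : Type u) [Ring A] (M : Type v) [AddCommGroup M] [Module A M] :
    Prop :=
  Nontrivial M ∧ ∀ p q : Submodule A M, IsCompl p q → p = ⊥ ∨ q = ⊥

/-- Finite representation type: up to isomorphism there are only finitely many finitely generated
indecomposable (left) modules. For `A` a finite-dimensional algebra over a field, a module is
finitely generated if and only if it is finite-dimensional. Every finitely generated module is a
quotient of some `Fin n → A`, so modules in the universe of `A` represent all of them. -/
def IsOfFiniteRepresentationType (A : Type u) [Ring A] : Prop :=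
  ∃ (m : ℕ) (F : Fin m → ModuleCat.{u} A),
    ∀ (M : Type u) [AddCommGroup M] [Module A M],
      Module.Finite A M → IsIndecomposableModule A M → ∃ i, Nonempty (M ≃ₗ[A] F i)

/-! Let `kX` be the natural permutation module of the monoid, with basis `X`, let `σ` be the sum of
the basis, and let `M` be an indecomposable module.

If all constant maps act alike on `M`, their common action is an idempotent endomorphism of `M`,
hence `0` or `1`. The submodules of `M` are then just its `G`-submodules, and `M` is simple by
Maschke's theorem.

Otherwise some `w : M` is moved to different places by different constants, and sending the basis
vector `x` to `const x • w` gives a nonconstant homomorphism `kX → M`. By two-transitivity the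
`G`-endomorphisms of `kX` have the form `v ↦ a • v + (c * ∑ v) • σ`. This description forces every
nonzero submodule of `kX` to contain all differences of basis vectors, so the homomorphism is
injective; it also allows a `G`-equivariant retraction of it, which exists by Maschke's theorem, to
be corrected by a multiple of `σ` to one that commutes with the constants. So `kX` is a direct
summand of `M`, that is, `M ≃ kX`. -/

open MonoidAlgebra

section FiniteLength

variable {A : Type u} [Ring A]

theorem exists_finite_simple_targets_of_isFiniteLength {P : Type u} [AddCommGroup P] [Module A P]
    (hP : IsFiniteLength A P) :
    ∃ S : Set (ModuleCat.{u} A), S.Finite ∧ ∀ (M : Type u) [AddCommGroup M] [Module A M],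
      IsSimpleModule A M → ∀ f : P →ₗ[A] M, f ≠ 0 → ∃ N ∈ S, Nonempty (M ≃ₗ[A] N) := by
  induction hP with
  | of_subsingleton =>
    exact ⟨∅, Set.finite_empty, fun M _ _ _ f hf => (hf (Subsingleton.elim f 0)).elim⟩
  | @of_simple_quotient P _ _ Q _ _ ih =>
    obtain ⟨S, hS, hSQ⟩ := ih
    refine ⟨insert (ModuleCat.of A (P ⧸ Q)) S, hS.insert _, fun M _ _ hM f hf => ?_⟩
    by_cases hfQ : f ∘ₗ Q.subtype = 0
    · have hle : Q ≤ LinearMap.ker f := fun x hx => LinearMap.congr_fun hfQ ⟨x, hx⟩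
      have hne : Q.liftQ f hle ≠ 0 := fun h => hf <| by
        rw [← Q.liftQ_mkQ f hle, h, LinearMap.zero_comp]
      exact ⟨_, Set.mem_insert _ _,
        ⟨(LinearEquiv.ofBijective _ (LinearMap.bijective_of_ne_zero hne)).symm⟩⟩
    · obtain ⟨N, hN, e⟩ := hSQ M hM _ hfQ
      exact ⟨N, Set.mem_insert_of_mem _ hN, e⟩

theorem exists_finite_simpleModules (A : Type u) [Ring A] [IsArtinianRing A] :
    ∃ S : Set (ModuleCat.{u} A), S.Finite ∧ ∀ (M : Type u) [AddCommGroup M] [Module A M],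
      IsSimpleModule A M → ∃ N ∈ S, Nonempty (M ≃ₗ[A] N) := by
  have hA : IsFiniteLength A A :=
    isFiniteLength_iff_isNoetherian_isArtinian.mpr ⟨inferInstance, inferInstance⟩
  obtain ⟨S, hS, hSA⟩ := exists_finite_simple_targets_of_isFiniteLength hA
  refine ⟨S, hS, fun M _ _ hM => ?_⟩
  have := IsSimpleModule.nontrivial A M
  obtain ⟨m, hm⟩ := exists_ne (0 : M)
  refine hSA M hM (LinearMap.toSpanSingleton A M m) fun h => hm ?_
  simpa using LinearMap.congr_fun h 1

theorem IsOfFiniteRepresentationType.of_finite {S : Set (ModuleCat.{u} A)} (hS : S.Finite)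
    (h : ∀ (M : Type u) [AddCommGroup M] [Module A M], Module.Finite A M →
      IsIndecomposableModule A M → ∃ N ∈ S, Nonempty (M ≃ₗ[A] N)) :
    IsOfFiniteRepresentationType A := by
  obtain ⟨n, F, -, rfl⟩ := hS.fin_param
  refine ⟨n, F, fun M _ _ hfin hM => ?_⟩
  obtain ⟨_, ⟨i, rfl⟩, φ⟩ := h M hfin hM
  exact ⟨i, φ⟩

end FiniteLength

namespace IsIndecomposableModule

variable {A : Type u} [Ring A] {M : Type v} [AddCommGroup M] [Module A M]

theorem isSimpleModule [IsSemisimpleModule A M] (hM : IsIndecomposableModule A M) :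
    IsSimpleModule A M := by
  have := hM.1
  refine (isSimpleModule_iff A M).mpr { eq_bot_or_eq_top := fun p => ?_ }
  obtain ⟨q, hpq⟩ := exists_isCompl p
  exact (hM.2 p q hpq).imp_right fun hq : q = ⊥ => eq_top_of_isCompl_bot (hq ▸ hpq)

theorem eq_zero_or_eq_one_of_isIdempotentElem (hM : IsIndecomposableModule A M)
    {e : Module.End A M} (he : IsIdempotentElem e) : e = 0 ∨ e = 1 := by
  refine (hM.2 _ _ (LinearMap.IsIdempotentElem.isCompl he)).imp LinearMap.range_eq_bot.mp
    fun hker => LinearMap.ext fun m => LinearMap.ker_eq_bot.mp hker ?_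
  exact LinearMap.congr_fun he m

theorem nonempty_linearEquiv_of_leftInverse (hM : IsIndecomposableModule A M) {N : Type*}
    [AddCommGroup N] [Module A N] [Nontrivial N] {j : N →ₗ[A] M} {f : M →ₗ[A] N}
    (hfj : f ∘ₗ j = .id) : Nonempty (M ≃ₗ[A] N) := by
  have hfj' (v : N) : f (j v) = v := LinearMap.congr_fun hfj v
  have hidem : IsIdempotentElem (j ∘ₗ f : Module.End A M) :=
    LinearMap.ext fun m => congrArg j (hfj' (f m))
  rcases hM.eq_zero_or_eq_one_of_isIdempotentElem hidem with h | h
  · obtain ⟨v, hv⟩ := exists_ne (0 : N)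
    have hfjfj : f (j (f (j v))) = 0 :=
      (congrArg f (LinearMap.congr_fun h (j v))).trans (map_zero f)
    exact (hv (by rwa [hfj', hfj'] at hfjfj)).elim
  · exact ⟨.ofLinearMap f j hfj h⟩

end IsIndecomposableModule

section Maschke

variable {k : Type*} [Field k] {H S : Type*} [Group H] [Finite H] [NeZero (Nat.card H : k)]
  [Monoid S] {M N : Type*} [AddCommGroup M] [Module k M] [Module k[S] M] [IsScalarTower k k[S] M]
  [AddCommGroup N] [Module k N] [Module k[S] N] [IsScalarTower k k[S] N]

theorem exists_equivariant_leftInverse_of_injective (φ : H →* S) (f : N →ₗ[k[S]] M)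
    (hf : Function.Injective f) :
    ∃ π : M →ₗ[k] N, (∀ v, π (f v) = v) ∧
      ∀ h m, π (single (φ h) (1 : k) • m) = single (φ h) (1 : k) • π m := by
  let r : k[H] →ₐ[k] k[S] := mapDomainAlgHom k k φ
  let _ : Module k[H] M := Module.compHom M r.toRingHom
  let _ : Module k[H] N := Module.compHom N r.toRingHom
  have : IsScalarTower k k[H] M := ⟨fun c a m => by
    change r (c • a) • m = c • r a • m
    rw [map_smul, smul_assoc]⟩
  have : IsScalarTower k k[H] N := ⟨fun c a m => by
    change r (c • a) • m = c • r a • m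
    rw [map_smul, smul_assoc]⟩
  let f' : N →ₗ[k[H]] M := { f with map_smul' := fun a v => f.map_smul (r a) v }
  obtain ⟨π, hπ⟩ := MonoidAlgebra.exists_leftInverse_of_injective f' (LinearMap.ker_eq_bot.mpr hf)
  refine ⟨π.restrictScalars k, LinearMap.congr_fun hπ, fun h m => ?_⟩
  have hr : r (single h 1) = single (φ h) 1 := by simp [r]
  rw [← hr]
  exact π.map_smul (single h 1) m

theorem isSemisimpleModule_of_range_or_scalar (φ : H →* S)
    (h : ∀ s : S, s ∈ Set.range φ ∨ ∃ d : k, ∀ m : M, single s (1 : k) • m = d • m) :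
    IsSemisimpleModule k[S] M where
  exists_isCompl p := by
    obtain ⟨π, hπ, hφ⟩ := exists_equivariant_leftInverse_of_injective φ p.subtype
      p.subtype_injective
    let f : M →ₗ[k[S]] p := equivariantOfLinearOfComm π fun s m => by
      obtain ⟨g, rfl⟩ | ⟨d, hd⟩ := h s
      · exact hφ g m
      · rw [hd, map_smul]
        exact Subtype.ext (hd (π m)).symm
    exact ⟨_, LinearMap.isCompl_of_proj (f := f) hπ⟩

end Maschke

section Transitivity

variable {H X : Type*} [Group H] [MulAction H X]

theorem natCast_card_ne_zero_of_isPretransitive {R : Type*} [Semiring R] [Nonempty X]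
    [MulAction.IsPretransitive H X] (h : (Nat.card H : R) ≠ 0) : (Nat.card X : R) ≠ 0 := by
  obtain ⟨x⟩ := ‹Nonempty X›
  rw [← (MulAction.stabilizer H x).card_mul_index, MulAction.index_stabilizer_of_transitive,
    Nat.cast_mul] at h
  exact right_ne_zero_of_mul h

theorem eq_ite_of_invariant_of_two_pretransitive [DecidableEq X]
    (hH : MulAction.IsMultiplyPretransitive H X 2) {Y : Type*} {t : X → X → Y}
    (ht : ∀ (h : H) x y, t (h • x) (h • y) = t x y) {x₀ y₀ : X} (h₀ : x₀ ≠ y₀) (x y : X) :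
    t x y = if x = y then t x₀ x₀ else t x₀ y₀ := by
  split_ifs with hxy
  · have := MulAction.isPretransitive_of_is_two_pretransitive (G := H) (α := X)
    obtain ⟨h, rfl⟩ := MulAction.exists_smul_eq H x₀ x
    rw [← hxy, ht]
  · obtain ⟨h, rfl, rfl⟩ := MulAction.is_two_pretransitive_iff.mp hH h₀ hxy
    exact ht h x₀ y₀

end Transitivity

namespace adjoinConstants

variable {X : Type v} {G : Subgroup (Equiv.Perm X)}

/-- The inclusion of the permutations in `G` into the monoid. -/
def perm (G : Subgroup (Equiv.Perm X)) : G →* adjoinConstants G where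
  toFun g := ⟨((g : Equiv.Perm X) : X → X), Or.inl ⟨g, g.2, rfl⟩⟩
  map_one' := rfl
  map_mul' _ _ := rfl

/-- The constant map with value `x`, as an element of the monoid. -/
def const (G : Subgroup (Equiv.Perm X)) (x : X) : adjoinConstants G :=
  ⟨Function.const X x, Or.inr ⟨x, rfl⟩⟩

theorem eq_perm_or_eq_const (s : adjoinConstants G) :
    (∃ g, s = perm G g) ∨ ∃ x, s = const G x := by
  obtain ⟨_, ⟨g, hg, rfl⟩ | ⟨x, rfl⟩⟩ := s
  exacts [Or.inl ⟨⟨g, hg⟩, rfl⟩, Or.inr ⟨x, rfl⟩]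

theorem const_mul (x : X) (s : adjoinConstants G) : const G x * s = const G x := rfl

theorem mul_const (s : adjoinConstants G) (x : X) : s * const G x = const G (s • x) := rfl

theorem perm_smul (g : G) (x : X) : perm G g • x = g • x := rfl

theorem const_smul (x y : X) : const G x • y = x := rfl

section Modules

variable {k : Type u} [CommRing k] {M : Type*} [AddCommGroup M] [Module k[adjoinConstants G] M]

theorem single_const_smul_single_smul (x : X) (s : adjoinConstants G) (m : M) :
    single (const G x) (1 : k) • single s (1 : k) • m = single (const G x) (1 : k) • m := by
  rw [smul_smul, single_mul_single, const_mul, one_mul]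

theorem single_smul_single_const_smul (s : adjoinConstants G) (x : X) (m : M) :
    single s (1 : k) • single (const G x) (1 : k) • m = single (const G (s • x)) (1 : k) • m := by
  rw [smul_smul, single_mul_single, mul_const, one_mul]

variable [Module k M] [IsScalarTower k k[adjoinConstants G] M]

theorem const_act_eq_zero_or_eq_self (hM : IsIndecomposableModule k[adjoinConstants G] M)
    (h : ∀ (x y : X) (m : M), single (const G x) (1 : k) • m = single (const G y) (1 : k) • m) :
    (∀ (x : X) (m : M), single (const G x) (1 : k) • m = 0) ∨
      ∀ (x : X) (m : M), single (const G x) (1 : k) • m = m := by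
  rcases isEmpty_or_nonempty X with _ | ⟨⟨x₀⟩⟩
  · exact Or.inl fun x => isEmptyElim x
  let e : Module.End k[adjoinConstants G] M :=
    equivariantOfLinearOfComm (GroupSMul.linearMap k M (const G x₀)) fun s m => by
      simp only [GroupSMul.linearMap_apply, single_const_smul_single_smul,
        single_smul_single_const_smul]
      exact h _ _ m
  have he : IsIdempotentElem e :=
    LinearMap.ext fun m => single_const_smul_single_smul x₀ (const G x₀) m
  exact (hM.eq_zero_or_eq_one_of_isIdempotentElem he).imp
    (fun h0 x m => (h x x₀ m).trans (LinearMap.congr_fun h0 m))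
    (fun h1 x m => (h x x₀ m).trans (LinearMap.congr_fun h1 m))

end Modules

section PermModule

/-- The natural permutation module `kX`: it has basis `X`, which the elements of the monoid permute
as self-maps of `X`. -/
abbrev PermModule (k : Type u) [CommRing k] (G : Subgroup (Equiv.Perm X)) : Type (max u v) :=
  (Representation.ofMulAction k (adjoinConstants G) X).asModule

namespace PermModule

/-- The basis of the permutation module given by the points of `X`. -/
noncomputable def basis (k : Type u) [CommRing k] (G : Subgroup (Equiv.Perm X)) :
    Module.Basis X k (PermModule k G) :=
  (MonoidAlgebra.basis X k).map
    (Representation.ofMulAction k (adjoinConstants G) X).asModuleEquiv.symm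

/-- The sum `σ` of all points of `X` in the permutation module. -/
noncomputable def sumBasis (k : Type u) [CommRing k] (G : Subgroup (Equiv.Perm X)) [Fintype X] :
    PermModule k G :=
  ∑ x, basis k G x

variable {k : Type u} [CommRing k]

theorem single_smul_basis (s : adjoinConstants G) (x : X) :
    single s (1 : k) • basis k G x = basis k G (s • x) := by
  rw [Representation.single_smul, one_smul]
  exact Representation.ofMulAction_single s x 1

theorem single_const_smul (x : X) (v : PermModule k G) :
    single (const G x) (1 : k) • v = (basis k G).sumCoords v • basis k G x := by
  suffices GroupSMul.linearMap k (PermModule k G) (const G x) =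
      (basis k G).sumCoords.smulRight (basis k G x) from LinearMap.congr_fun this v
  refine (basis k G).ext fun y => ?_
  rw [GroupSMul.linearMap_apply, single_smul_basis, const_smul, LinearMap.smulRight_apply,
    Module.Basis.sumCoords_self_apply, one_smul]

theorem sumCoords_single_smul (s : adjoinConstants G) (v : PermModule k G) :
    (basis k G).sumCoords (single s (1 : k) • v) = (basis k G).sumCoords v := by
  suffices (basis k G).sumCoords ∘ₗ GroupSMul.linearMap k (PermModule k G) s =
      (basis k G).sumCoords from LinearMap.congr_fun this v
  refine (basis k G).ext fun y => ?_
  rw [LinearMap.comp_apply, GroupSMul.linearMap_apply, single_smul_basis,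
    Module.Basis.sumCoords_self_apply, Module.Basis.sumCoords_self_apply]

theorem coord_smul_single_perm_smul (g : G) (x : X) (v : PermModule k G) :
    (basis k G).coord (g • x) (single (perm G g) (1 : k) • v) = (basis k G).coord x v := by
  classical
  suffices (basis k G).coord (g • x) ∘ₗ GroupSMul.linearMap k (PermModule k G) (perm G g) =
      (basis k G).coord x from LinearMap.congr_fun this v
  refine (basis k G).ext fun y => ?_
  rw [LinearMap.comp_apply, GroupSMul.linearMap_apply, single_smul_basis, perm_smul]
  simp [Finsupp.single_apply]

variable {M : Type*} [AddCommGroup M] [Module k M] [Module k[adjoinConstants G] M]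
  [IsScalarTower k k[adjoinConstants G] M]

/-- The homomorphism `kX → M` sending each `x : X` to the action of the constant `x` on `w`. -/
noncomputable def ofConstSMul (w : M) : PermModule k G →ₗ[k[adjoinConstants G]] M :=
  equivariantOfLinearOfComm
    ((basis k G).constr k fun x => single (const G x) (1 : k) • w) fun s v => by
      suffices (basis k G).constr k (fun x => single (const G x) (1 : k) • w) ∘ₗ
          GroupSMul.linearMap k (PermModule k G) s =
          GroupSMul.linearMap k M s ∘ₗ
            (basis k G).constr k (fun x => single (const G x) (1 : k) • w) from
        LinearMap.congr_fun this v
      refine (basis k G).ext fun x => ?_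
      simp only [LinearMap.comp_apply, GroupSMul.linearMap_apply, single_smul_basis,
        Module.Basis.constr_basis, single_smul_single_const_smul]

theorem ofConstSMul_basis (w : M) (x : X) :
    ofConstSMul w (basis k G x) = single (const G x) (1 : k) • w :=
  (basis k G).constr_basis k _ x

variable [Fintype X]

theorem sumCoords_sumBasis : (basis k G).sumCoords (sumBasis k G) = Nat.card X := by
  simp [sumBasis]

theorem coord_sumBasis (x : X) : (basis k G).coord x (sumBasis k G) = 1 := by
  classical simp [sumBasis, Finsupp.single_apply]

theorem single_perm_smul_sumBasis (g : G) :
    single (perm G g) (1 : k) • sumBasis k G = sumBasis k G := by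
  simp only [sumBasis, Finset.smul_sum, single_smul_basis, perm_smul]
  exact Equiv.sum_comp (MulAction.toPerm g) (basis k G)

theorem single_const_smul_sumBasis (x : X) :
    single (const G x) (1 : k) • sumBasis k G = (Nat.card X : k) • basis k G x := by
  rw [single_const_smul, sumCoords_sumBasis]

theorem apply_eq_of_equivariant (hG : MulAction.IsMultiplyPretransitive G X 2)
    {u : X → PermModule k G} (hu : ∀ (g : G) x, u (g • x) = single (perm G g) (1 : k) • u x)
    {x₀ y₀ : X} (h₀ : x₀ ≠ y₀) (x : X) :
    u x = ((basis k G).coord x₀ (u x₀) - (basis k G).coord y₀ (u x₀)) • basis k G x +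
      (basis k G).coord y₀ (u x₀) • sumBasis k G := by
  classical
  refine (basis k G).ext_elem fun y => ?_
  simp only [← Module.Basis.coord_apply]
  rw [eq_ite_of_invariant_of_two_pretransitive hG (t := fun x y => (basis k G).coord y (u x))
    (fun g x y => by rw [hu, coord_smul_single_perm_smul]) h₀ x y]
  rw [map_add, map_smul, map_smul, coord_sumBasis, Module.Basis.coord_apply _ _ (basis k G x),
    Module.Basis.repr_self, Finsupp.single_apply, smul_eq_mul, smul_eq_mul]
  split_ifs <;> ring

theorem exists_apply_eq_smul_add_smul_sumBasis [Nontrivial X]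
    (hG : MulAction.IsMultiplyPretransitive G X 2) {T : PermModule k G →ₗ[k] PermModule k G}
    (hT : ∀ g v, T (single (perm G g) (1 : k) • v) = single (perm G g) (1 : k) • T v) :
    ∃ a c : k, ∀ v, T v = a • v + (c * (basis k G).sumCoords v) • sumBasis k G := by
  obtain ⟨x₀, y₀, h₀⟩ := exists_pair_ne X
  obtain ⟨a, c, hTx⟩ : ∃ a c : k, ∀ x, T (basis k G x) = a • basis k G x + c • sumBasis k G :=
    ⟨_, _, apply_eq_of_equivariant hG (u := fun x => T (basis k G x))
      (fun g x => by rw [← hT, single_smul_basis, perm_smul]) h₀⟩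
  refine ⟨a, c, fun v => ?_⟩
  suffices T = a • LinearMap.id + (c • (basis k G).sumCoords).smulRight (sumBasis k G) from
    LinearMap.congr_fun this v
  refine (basis k G).ext fun x => (hTx x).trans ?_
  simp only [LinearMap.add_apply, LinearMap.smul_apply, LinearMap.id_apply,
    LinearMap.smulRight_apply, Module.Basis.sumCoords_self_apply, smul_eq_mul, mul_one]

end PermModule
end PermModule

section FieldCoefficients

variable {k : Type u} [Field k] {M : Type*} [AddCommGroup M] [Module k M]
  [Module k[adjoinConstants G] M] [IsScalarTower k k[adjoinConstants G] M]

theorem isSimpleModule_of_const_act_eq [Finite G] [NeZero (Nat.card G : k)]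
    (hM : IsIndecomposableModule k[adjoinConstants G] M)
    (h : ∀ (x y : X) (m : M), single (const G x) (1 : k) • m = single (const G y) (1 : k) • m) :
    IsSimpleModule k[adjoinConstants G] M := by
  have hd : ∃ d : k, ∀ (x : X) (m : M), single (const G x) (1 : k) • m = d • m :=
    (const_act_eq_zero_or_eq_self hM h).elim (fun h0 => ⟨0, by simpa only [zero_smul] using h0⟩)
      (fun h1 => ⟨1, by simpa only [one_smul] using h1⟩)
  obtain ⟨d, hd⟩ := hd
  have : IsSemisimpleModule k[adjoinConstants G] M :=
    isSemisimpleModule_of_range_or_scalar (perm G) fun s =>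
      (eq_perm_or_eq_const s).imp (fun ⟨g, hg⟩ => ⟨g, hg.symm⟩)
        (fun ⟨x, hx⟩ => ⟨d, by simpa only [hx] using hd x⟩)
  exact hM.isSimpleModule

namespace PermModule

theorem eq_bot_or_basis_sub_basis_mem [Finite X] [Nontrivial X] [NeZero (Nat.card G : k)]
    (hG : MulAction.IsMultiplyPretransitive G X 2)
    (K : Submodule k[adjoinConstants G] (PermModule k G)) :
    K = ⊥ ∨ ∀ x y, basis k G x - basis k G y ∈ K := by
  cases nonempty_fintype X
  refine or_iff_not_imp_left.mpr fun hK x y => ?_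
  by_cases hε : ∀ b ∈ K, (basis k G).sumCoords b = 0
  · obtain ⟨π, hπ, hπG⟩ := exists_equivariant_leftInverse_of_injective (k := k) (N := K)
      (perm G) K.subtype K.subtype_injective
    obtain ⟨a, c, hT⟩ := exists_apply_eq_smul_add_smul_sumBasis hG
      (T := K.subtype.restrictScalars k ∘ₗ π) fun g v => congrArg K.subtype (hπG g v)
    obtain ⟨b, hbK, hb⟩ := K.ne_bot_iff.mp hK
    have ha : a = 1 := by
      have hTb : b = a • b + (c * (basis k G).sumCoords b) • sumBasis k G :=
        (congrArg K.subtype (hπ ⟨b, hbK⟩)).symm.trans (hT b)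
      rw [hε b hbK, mul_zero, zero_smul, add_zero] at hTb
      exact smul_left_injective k hb (by simpa only [one_smul] using hTb.symm)
    have hmem : (π (basis k G x - basis k G y) : PermModule k G) = basis k G x - basis k G y :=
      (hT _).trans (by simp [ha])
    exact hmem ▸ (π _).2
  · push Not at hε
    obtain ⟨b, hbK, hb⟩ := hε
    have hbasis (z : X) : basis k G z ∈ K := by
      have := K.smul_mem (algebraMap k k[adjoinConstants G] ((basis k G).sumCoords b)⁻¹)
        (K.smul_mem (single (const G z) 1) hbK)
      rwa [single_const_smul, algebraMap_smul, inv_smul_smul₀ hb] at this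
    exact K.sub_mem (hbasis x) (hbasis y)

theorem exists_hom_eq_add_smul_sumBasis [Fintype X] [Nontrivial X]
    (hG : MulAction.IsMultiplyPretransitive G X 2) (hX : (Nat.card X : k) ≠ 0)
    {π : M →ₗ[k] PermModule k G}
    (hπ : ∀ g m, π (single (perm G g) (1 : k) • m) = single (perm G g) (1 : k) • π m) :
    ∃ f : M →ₗ[k[adjoinConstants G]] PermModule k G,
      ∀ m, ∃ τ : k, f m = π m + τ • sumBasis k G := by
  obtain ⟨x₀, y₀, h₀⟩ := exists_pair_ne X
  let p : M →ₗ[k] PermModule k G := π ∘ₗ GroupSMul.linearMap k M (const G x₀)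
  let ℓ : M →ₗ[k] k := ((basis k G).coord x₀ - (basis k G).coord y₀) ∘ₗ p
  let ℓ' : M →ₗ[k] k := (basis k G).coord y₀ ∘ₗ p
  have hπc (x : X) (m : M) :
      π (single (const G x) (1 : k) • m) = ℓ m • basis k G x + ℓ' m • sumBasis k G :=
    apply_eq_of_equivariant hG (u := fun x => π (single (const G x) (1 : k) • m))
      (fun g x => by rw [← hπ, single_smul_single_const_smul, perm_smul]) h₀ x
  have hℓ (s : adjoinConstants G) (m : M) : ℓ (single s (1 : k) • m) = ℓ m :=
    congrArg (fun m => ((basis k G).coord x₀ - (basis k G).coord y₀) (π m))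
      (single_const_smul_single_smul x₀ s m)
  -- `const x` sends `π m + t m • σ` to a multiple of `x`; it has to be `ℓ m`, which determines `t`.
  let t : M →ₗ[k] k := (Nat.card X : k)⁻¹ • (ℓ - (basis k G).sumCoords ∘ₗ π)
  have ht (m : M) : t m = (Nat.card X : k)⁻¹ * (ℓ m - (basis k G).sumCoords (π m)) := rfl
  refine ⟨equivariantOfLinearOfComm (π + t.smulRight (sumBasis k G)) fun s m => ?_,
    fun m => ⟨t m, rfl⟩⟩
  simp only [LinearMap.add_apply, LinearMap.smulRight_apply, smul_add]
  obtain ⟨g, rfl⟩ | ⟨x, rfl⟩ := eq_perm_or_eq_const s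
  · rw [ht, ht, hℓ, hπ, sumCoords_single_smul, smul_algebra_smul_comm, single_perm_smul_sumBasis]
  · rw [ht, ht, hℓ, hπc, single_const_smul, smul_algebra_smul_comm, single_const_smul_sumBasis,
      map_add, map_smul, map_smul, Module.Basis.sumCoords_self_apply, sumCoords_sumBasis]
    simp only [smul_eq_mul]
    match_scalars <;> field_simp <;> ring

theorem exists_leftInverse_of_injective [Finite X] [Nontrivial X] [NeZero (Nat.card G : k)]
    (hG : MulAction.IsMultiplyPretransitive G X 2)
    {j : PermModule k G →ₗ[k[adjoinConstants G]] M} (hj : Function.Injective j) :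
    ∃ f : M →ₗ[k[adjoinConstants G]] PermModule k G, f ∘ₗ j = .id := by
  cases nonempty_fintype X
  have := MulAction.isPretransitive_of_is_two_pretransitive (G := G) (α := X)
  have hX : (Nat.card X : k) ≠ 0 :=
    natCast_card_ne_zero_of_isPretransitive (H := G) (NeZero.ne _)
  obtain ⟨π, hπ, hπG⟩ := exists_equivariant_leftInverse_of_injective (k := k) (perm G) j hj
  obtain ⟨f, hf⟩ := exists_hom_eq_add_smul_sumBasis hG hX hπG
  refine ⟨f, LinearMap.restrictScalars_injective k ((basis k G).ext fun x => ?_)⟩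
  obtain ⟨τ, hτ⟩ := hf (j (basis k G x))
  rw [hπ] at hτ
  have hfix : f (j (basis k G x)) =
      (basis k G).sumCoords (f (j (basis k G x))) • basis k G x := by
    rw [← single_const_smul, ← map_smul, ← map_smul, single_smul_basis, const_smul]
  obtain ⟨y, hy⟩ := exists_ne x
  have hτ0 : τ = 0 := by
    have := congrArg ((basis k G).coord y) (hτ.symm.trans hfix)
    rwa [map_add, map_smul, map_smul, coord_sumBasis, Module.Basis.coord_apply,
      Module.Basis.repr_self, Finsupp.single_eq_of_ne hy, zero_add, smul_eq_mul, mul_one,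
      smul_zero] at this
  simpa [hτ0] using hτ

end PermModule

theorem nonempty_linearEquiv_permModule [Finite X] [NeZero (Nat.card G : k)]
    (hG : MulAction.IsMultiplyPretransitive G X 2)
    (hM : IsIndecomposableModule k[adjoinConstants G] M) {x y : X} {w : M}
    (hw : single (const G x) (1 : k) • w ≠ single (const G y) (1 : k) • w) :
    Nonempty (M ≃ₗ[k[adjoinConstants G]] PermModule k G) := by
  have : Nontrivial X := ⟨x, y, fun h => hw (h ▸ rfl)⟩
  have hker : LinearMap.ker (PermModule.ofConstSMul (k := k) (G := G) w) = ⊥ := by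
    refine (PermModule.eq_bot_or_basis_sub_basis_mem hG _).resolve_right fun h => hw ?_
    simpa only [LinearMap.mem_ker, map_sub, PermModule.ofConstSMul_basis, sub_eq_zero]
      using h x y
  obtain ⟨f, hf⟩ := PermModule.exists_leftInverse_of_injective hG (LinearMap.ker_eq_bot.mp hker)
  have := (PermModule.basis k G).repr.toEquiv.nontrivial
  exact hM.nonempty_linearEquiv_of_leftInverse hf

end FieldCoefficients
end adjoinConstants

theorem mainTheorem7_general {k : Type*} [Field k] {X : Type*} [Finite X]
    (G : Subgroup (Equiv.Perm X)) [NeZero (Nat.card G : k)]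
    (hG : MulAction.IsMultiplyPretransitive G X 2) :
    IsOfFiniteRepresentationType (MonoidAlgebra k (adjoinConstants G)) := by
  have : Finite (Function.End X) := inferInstanceAs (Finite (X → X))
  have := IsArtinianRing.of_finite k k[adjoinConstants G]
  obtain ⟨S, hS, hSA⟩ := exists_finite_simpleModules k[adjoinConstants G]
  refine .of_finite (hS.insert (ModuleCat.of _ (adjoinConstants.PermModule k G)))
    fun M _ _ _ hM => ?_
  let _ : Module k M := Module.compHom M (algebraMap k k[adjoinConstants G])
  have : IsScalarTower k k[adjoinConstants G] M := .of_compHom k _ M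
  by_cases h : ∀ (x y : X) (m : M), single (adjoinConstants.const G x) (1 : k) • m =
      single (adjoinConstants.const G y) (1 : k) • m
  · obtain ⟨N, hN, e⟩ := hSA M (adjoinConstants.isSimpleModule_of_const_act_eq hM h)
    exact ⟨N, Set.mem_insert_of_mem _ hN, e⟩
  · push Not at h
    obtain ⟨x, y, w, hw⟩ := h
    exact ⟨_, Set.mem_insert _ _, adjoinConstants.nonempty_linearEquiv_permModule hG hM hw⟩

theorem mainTheorem7 {k : Type*} [Field k] [IsAlgClosed k] [CharZero k]
    {X : Type*} [Finite X] (G : Subgroup (Equiv.Perm X))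
    (hG : MulAction.IsMultiplyPretransitive G X 2) :
    IsOfFiniteRepresentationType (MonoidAlgebra k (adjoinConstants G)) :=
  have : NeZero (Nat.card G : k) := ⟨Nat.cast_ne_zero.mpr Nat.card_pos.ne'⟩
  mainTheorem7_general G hG
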